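/- Let $G$ be a finite simple undirected graph with $n$ vertices, $m$ edges and maximum degree $\Delta$, and let $A_\alpha(G)=\alpha D(G)+(1-\alpha)A(G)$, where $A(G)$ is the adjacency matrix of $G$ and $D(G)$ is the diagonal matrix of its vertex degrees. Let $\rho_\alpha(G)$ denote the largest eigenvalue of the real symmetric matrix $A_\alpha(G)$. Let $k\ge 1$ be an integer and suppose that $G$ is $k$-connected (that is, $n>k$ and deleting any set of fewer than $k$ vertices leaves a connected graph) and irregular (that is, not all vertices of $G$ have the same degree). Then for every real $\alpha$ with $0\le\alpha<1$, $$\rho_\alpha(G)<\Delta-\frac{(1-\alpha)(n\Delta-2m)k^2}{(n\Delta-2m)\bigl(n^2-(\Delta-k+2)(n-k)\bigr)+(1-\alpha)nk^2}.$$ -/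

import Mathlib

namespace SimpleGraph

/-- `G` is `k`-connected: it has more than `k` vertices, and deleting any set of fewer than `k`
vertices leaves a connected graph. -/
def IsKConnected {V : Type*} [Fintype V] (G : SimpleGraph V) (k : ℕ) : Prop :=
  k < Fintype.card V ∧ ∀ S : Finset V, S.card < k → (G.induce {v : V | v ∉ S}).Connected

/-- `G` is irregular: its vertices do not all have the same degree. -/
def IsIrregular {V : Type*} (G : SimpleGraph V) [G.LocallyFinite] : Prop :=
  ¬ ∃ d : ℕ, G.IsRegularOfDegree d

/-- The matrix `A_α(G) = α D(G) + (1 - α) A(G)`, where `D(G)` is the diagonal matrix of the vertex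
degrees and `A(G)` is the adjacency matrix. -/
def alphaMatrix {V : Type*} [Fintype V] [DecidableEq V] (G : SimpleGraph V) [DecidableRel G.Adj]
    (α : ℝ) : Matrix V V ℝ :=
  α • Matrix.diagonal (fun v => (G.degree v : ℝ)) + (1 - α) • G.adjMatrix ℝ

/-- The `α`-spectral radius of `G`: the largest (real) eigenvalue of the symmetric matrix
`A_α(G)`. -/
noncomputable def alphaSpectralRadius {V : Type*} [Fintype V] [DecidableEq V] (G : SimpleGraph V)
    [DecidableRel G.Adj] (α : ℝ) : ℝ :=
  sSup (spectrum ℝ (G.alphaMatrix α))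

theorem alphaMatrix_isHermitian {V : Type*} [Fintype V] [DecidableEq V] (G : SimpleGraph V)
    [DecidableRel G.Adj] (α : ℝ) : (G.alphaMatrix α).IsHermitian := by
  unfold alphaMatrix Matrix.IsHermitian
  rw [Matrix.conjTranspose_eq_transpose_of_trivial]
  simp [Matrix.transpose_add, Matrix.transpose_smul]

/-- The supremum in the definition of the `α`-spectral radius is attained: it really is the largest
eigenvalue. -/
theorem isGreatest_alphaSpectralRadius {V : Type*} [Fintype V] [DecidableEq V] [Nonempty V]
    (G : SimpleGraph V) [DecidableRel G.Adj] (α : ℝ) :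
    IsGreatest {μ : ℝ | Module.End.HasEigenvalue (Matrix.toLin' (G.alphaMatrix α)) μ}
      (G.alphaSpectralRadius α) := by
  have hS : {μ : ℝ | Module.End.HasEigenvalue (Matrix.toLin' (G.alphaMatrix α)) μ} =
      spectrum ℝ (G.alphaMatrix α) := by
    ext μ
    rw [Set.mem_ofPred_eq, Module.End.hasEigenvalue_iff_mem_spectrum, Matrix.spectrum_toLin']
  have hR := (G.alphaMatrix_isHermitian α).spectrum_real_eq_range_eigenvalues
  have hfin : (spectrum ℝ (G.alphaMatrix α)).Finite := by
    rw [hR]; exact Set.finite_range _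
  have hne : (spectrum ℝ (G.alphaMatrix α)).Nonempty := by
    rw [hR]; exact Set.range_nonempty _
  rw [hS]
  exact ⟨hne.csSup_mem hfin, fun _ h => le_csSup hfin.bddAbove h⟩

end SimpleGraph

/-!
Let `x` be an eigenvector for `ρ_α` and let `E` denote the Dirichlet energy, the sum of
`(x i - x j) ^ 2` over the edges. Passing to `y = |x|` does not increase the energy, so
`(Δ - ρ_α) ∑ y i ^ 2 ≥ ∑ (Δ - deg i) y i ^ 2 + (1 - α) E ≥ (n Δ - 2 m) t ^ 2 + (1 - α) E`, where
`t` is the minimum of `y`, attained at `v`. It remains to bound `∑ (y i - t) ^ 2` in terms of `E`.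

Let `y` be maximal at `u`. If `deg u < Δ`, the eigenvalue equation at `u` gives `ρ_α ≤ Δ - 1`, which
is more than enough. Otherwise there are `k` internally disjoint paths from `u` to `v`, of total
length at most `L = n - Δ + 2k - 2`, since only `k` of the `Δ` neighbours of `u` need to occur on
them; by the Cauchy-Schwarz inequality, `k ^ 2 (y u - t) ^ 2 ≤ L E`
(`IsKConnected.sq_mul_sub_le_mul_dirichletEnergy`). Moreover `k` neighbours of `v` together
contribute at most `E` to `∑ (y i - t) ^ 2`, and `v` contributes nothing, so that
`k ^ 2 ∑ (y i - t) ^ 2 ≤ ((n - k - 1) L + k ^ 2) E` (`IsKConnected.sum_sq_sub_le`). Because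
`n ^ 2 - (Δ - k + 2) (n - k) = (n - k) L + k ^ 2`, minimizing over `t` yields the bound, and the
summand `L` to spare makes it strict.

The disjoint paths are obtained without Menger's theorem (`exists_injective_pathStep`): a system of
`k` disjoint paths, with all unused vertices mapped to themselves, is a bijection from the vertices
together with `k` copies of `u` to the vertices together with `k` copies of `v`. Hall's theorem
provides it, and it may contain cycles, which are harmless: only the telescoping sum of the
differences along all steps matters. Steps into neighbours of `u` can be reserved to `u` without
affecting Hall's condition, since a set of vertices containing `u` already reaches all of them;
this is what keeps `L` small.
-/

namespace SimpleGraph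

open Finset

variable {V : Type*} [Fintype V]

/-! ### The Dirichlet energy of a function on the vertices -/

/-- The Dirichlet energy of `x : V → ℝ` on the graph `G`, that is, the sum of `(x a - x b) ^ 2` over
the edges `ab`. It is written as half of the sum over ordered pairs, so each edge counts once. -/
noncomputable def dirichletEnergy (G : SimpleGraph V) [DecidableRel G.Adj] (x : V → ℝ) : ℝ :=
  (∑ i, ∑ j, if G.Adj i j then (x i - x j) ^ 2 else 0) / 2

theorem dirichletEnergy_nonneg (G : SimpleGraph V) [DecidableRel G.Adj] (x : V → ℝ) :
    0 ≤ G.dirichletEnergy x := by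
  unfold dirichletEnergy
  have : 0 ≤ ∑ i, ∑ j, if G.Adj i j then (x i - x j) ^ 2 else 0 :=
    sum_nonneg fun i _ => sum_nonneg fun j _ => by split_ifs <;> positivity
  linarith

/-- A set of edges, each listed with one orientation only, contributes at most the full energy. -/
theorem sum_sq_le_dirichletEnergy [DecidableEq V] (G : SimpleGraph V) [DecidableRel G.Adj]
    (x : V → ℝ) (B : Finset (V × V)) (hadj : ∀ p ∈ B, G.Adj p.1 p.2) (hanti : ∀ p ∈ B, p.swap ∉ B) :
    ∑ p ∈ B, (x p.1 - x p.2) ^ 2 ≤ G.dirichletEnergy x := by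
  have h1 : ∑ p ∈ B.map (Equiv.prodComm V V).toEmbedding, (x p.1 - x p.2) ^ 2
      = ∑ p ∈ B, (x p.1 - x p.2) ^ 2 := by
    rw [sum_map]
    exact sum_congr rfl fun p _ => by simp; ring
  have hd : Disjoint B (B.map (Equiv.prodComm V V).toEmbedding) := by
    rw [Finset.disjoint_left]
    intro p hp hp'
    obtain ⟨q, hq, rfl⟩ := mem_map.1 hp'
    exact hanti q hq (by simpa using hp)
  have h2 : ∑ p ∈ B ∪ B.map (Equiv.prodComm V V).toEmbedding, (x p.1 - x p.2) ^ 2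
      ≤ ∑ p ∈ univ.filter (fun p : V × V => G.Adj p.1 p.2), (x p.1 - x p.2) ^ 2 := by
    refine sum_le_sum_of_subset_of_nonneg ?_ fun _ _ _ => sq_nonneg _
    intro p hp
    rw [mem_union] at hp
    simp only [mem_filter, mem_univ, true_and]
    rcases hp with hp | hp
    · exact hadj p hp
    · obtain ⟨q, hq, rfl⟩ := mem_map.1 hp
      exact (hadj q hq).symm
  rw [sum_union hd, h1, sum_filter, Fintype.sum_prod_type] at h2
  unfold dirichletEnergy
  linarith

theorem dirichletEnergy_deleteEdge_add_le [DecidableEq V] (G : SimpleGraph V) [DecidableRel G.Adj]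
    (x : V → ℝ) {u v : V} (huv : G.Adj u v) [DecidableRel (G.deleteEdges {s(u, v)}).Adj] :
    (G.deleteEdges {s(u, v)}).dirichletEnergy x + (x u - x v) ^ 2 ≤ G.dirichletEnergy x := by
  have hne := huv.ne
  have key : ∀ i j, (if (G.deleteEdges {s(u, v)}).Adj i j then (x i - x j) ^ 2 else 0)
      + ((if i = u then if j = v then (x u - x v) ^ 2 else 0 else 0)
        + (if i = v then if j = u then (x u - x v) ^ 2 else 0 else 0))
      ≤ if G.Adj i j then (x i - x j) ^ 2 else 0 := by
    intro i j
    by_cases h1 : i = u ∧ j = v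
    · obtain ⟨rfl, rfl⟩ := h1
      simp [huv, hne]
    by_cases h2 : i = v ∧ j = u
    · obtain ⟨rfl, rfl⟩ := h2
      simp only [deleteEdges_adj, Set.mem_singleton_iff, Sym2.eq_swap, not_true_eq_false, and_false,
        if_false, hne.symm, if_true, huv.symm]
      nlinarith
    have h3 : (if i = u then if j = v then (x u - x v) ^ 2 else 0 else 0) = 0 := by
      split_ifs <;> simp_all
    have h4 : (if i = v then if j = u then (x u - x v) ^ 2 else 0 else 0) = 0 := by
      split_ifs <;> simp_all
    rw [h3, h4]
    simp only [deleteEdges_adj]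
    split_ifs with h5 h6
    · simp
    · exact absurd h5.1 h6
    · simp [sq_nonneg]
    · simp
  have hs := sum_le_sum fun i (_ : i ∈ univ) => sum_le_sum fun j (_ : j ∈ univ) => key i j
  simp only [sum_add_distrib] at hs
  have h5 : ∑ i : V, ∑ j : V, (if i = u then if j = v then (x u - x v) ^ 2 else 0 else 0)
      = (x u - x v) ^ 2 := by
    rw [sum_eq_single u (by intro b _ hb; simp [hb]) (by simp)]; simp
  have h6 : ∑ i : V, ∑ j : V, (if i = v then if j = u then (x u - x v) ^ 2 else 0 else 0)
      = (x u - x v) ^ 2 := by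
    rw [sum_eq_single v (by intro b _ hb; simp [hb]) (by simp)]; simp
  rw [h5, h6] at hs
  unfold dirichletEnergy
  linarith

/-! ### Disjoint paths from Hall's theorem -/

/-- The step relation of a system of `k` paths from `u` to `v`. The copies `inr i` on the left are
the `k` starts at `u`, those on the right the `k` ends at `v`; `inl w` on both sides is the vertex
`w`, and stepping from `inl w` to itself means that no path uses `w`. A neighbour of `u` may only be
entered from `u`, which makes shortcuts through `u` impossible. -/
def PathStep (G : SimpleGraph V) (u v : V) (k : ℕ) : V ⊕ Fin k → V ⊕ Fin k → Prop
  | .inl w, .inl z => z = w ∨ (G.Adj w z ∧ w ≠ u ∧ w ≠ v ∧ z ≠ u ∧ z ≠ v ∧ ¬ G.Adj u z)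
  | .inl w, .inr _ => G.Adj w v
  | .inr _, .inl z => G.Adj u z
  | .inr _, .inr _ => False

/-- A form of Menger's theorem, with the path system encoded as an injective choice of steps. It
follows from Hall's marriage theorem: a set of left elements containing a start at `u` violates
Hall's condition only if its vertices have a boundary of fewer than `k` vertices avoiding `v`. -/
theorem exists_injective_pathStep [DecidableEq V] (G : SimpleGraph V) {u v : V} (huv : u ≠ v)
    (hadj : ¬ G.Adj u v) (k : ℕ)
    (hcut : ∀ S R : Finset V, u ∈ S → v ∉ S → v ∉ R →
      (∀ a ∈ S, ∀ b, G.Adj a b → b ∈ S ∨ b ∈ R) → k ≤ #R) :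
    ∃ f : V ⊕ Fin k → V ⊕ Fin k, Function.Injective f ∧ ∀ a, G.PathStep u v k a (f a) := by
  classical
  rw [← Fintype.all_card_le_filter_rel_iff_exists_injective]
  intro A
  set N : Finset (V ⊕ Fin k) := {b | ∃ a ∈ A, G.PathStep u v k a b} with hN
  have memN : ∀ b, b ∈ N ↔ ∃ a ∈ A, G.PathStep u v k a b := fun b => by simp [hN]
  have hsub : A.toLeft ⊆ N.toLeft := by
    intro w hw
    rw [mem_toLeft] at hw ⊢
    exact (memN _).2 ⟨_, hw, Or.inl rfl⟩
  rw [← card_toLeft_add_card_toRight (u := A), ← card_toLeft_add_card_toRight (u := N)]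
  by_cases hT : A.toRight = ∅
  · rw [hT, card_empty]
    have := card_le_card hsub
    omega
  obtain ⟨i, hi⟩ := nonempty_iff_ne_empty.2 hT
  rw [mem_toRight] at hi
  have hk : #A.toRight ≤ k := by simpa using card_le_univ A.toRight
  by_cases hv : ∃ w ∈ A.toLeft, G.Adj w v
  · obtain ⟨w, hw, hwv⟩ := hv
    rw [mem_toLeft] at hw
    have : N.toRight = univ := by
      ext j
      simp only [mem_toRight, mem_univ, iff_true]
      exact (memN _).2 ⟨_, hw, hwv⟩
    rw [this, card_univ, Fintype.card_fin]
    have := card_le_card hsub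
    omega
  push Not at hv
  have hR := hcut (insert u (A.toLeft.erase v)) ((N.toLeft \ insert u (A.toLeft.erase v)).erase v)
    (mem_insert_self _ _) (by simp [huv.symm]) (notMem_erase _ _) (by
      intro a ha b hab
      by_cases hbS : b ∈ insert u (A.toLeft.erase v)
      · exact Or.inl hbS
      refine Or.inr ?_
      have hbu : b ≠ u := fun h => hbS (by simp [h])
      have hbv : b ≠ v := by
        rintro rfl
        rcases mem_insert.1 ha with rfl | ha
        · exact hadj hab
        · exact hv a (mem_of_mem_erase ha) hab
      rw [mem_erase, mem_sdiff, mem_toLeft, memN]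
      refine ⟨hbv, ?_, hbS⟩
      by_cases hub : G.Adj u b
      · exact ⟨_, hi, hub⟩
      rcases mem_insert.1 ha with rfl | ha
      · exact absurd hab hub
      rw [mem_erase, mem_toLeft] at ha
      have hau : a ≠ u := by rintro rfl; exact hub hab
      exact ⟨_, ha.2, Or.inr ⟨hab, hau, ha.1, hbu, hbv, hub⟩⟩)
  have hdisj : Disjoint A.toLeft ((N.toLeft \ insert u (A.toLeft.erase v)).erase v) := by
    rw [Finset.disjoint_left]
    intro w hw hw'
    rw [mem_erase, mem_sdiff] at hw'
    exact hw'.2.2 (mem_insert_of_mem (mem_erase.2 ⟨hw'.1, hw⟩))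
  have hle : #(A.toLeft ∪ (N.toLeft \ insert u (A.toLeft.erase v)).erase v) ≤ #N.toLeft :=
    card_le_card (union_subset hsub ((erase_subset _ _).trans sdiff_subset))
  rw [card_union_of_disjoint hdisj] at hle
  omega

/-- If `u` and `v` are nonadjacent and cannot be separated by fewer than `k` vertices, then `k`
disjoint paths from `u` to `v` of total length at most `n - 2 + 2k - deg u` bound the difference of
the values of `x` at `u` and `v` in terms of the energy of `x`. -/
theorem sq_mul_sub_le_mul_dirichletEnergy_of_not_adj [DecidableEq V] (G : SimpleGraph V)
    [DecidableRel G.Adj] {u v : V} (huv : u ≠ v) (hadj : ¬ G.Adj u v) (k : ℕ)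
    (hcut : ∀ S R : Finset V, u ∈ S → v ∉ S → v ∉ R →
      (∀ a ∈ S, ∀ b, G.Adj a b → b ∈ S ∨ b ∈ R) → k ≤ #R) (x : V → ℝ) :
    ((k : ℝ) * (x u - x v)) ^ 2
      ≤ ((Fintype.card V : ℝ) - 2 + 2 * k - G.degree u) * G.dirichletEnergy x := by
  classical
  obtain ⟨f, hinj, hf⟩ := G.exists_injective_pathStep huv hadj k hcut
  have hbij : Function.Bijective f := Finite.injective_iff_bijective.1 hinj
  have noRR : ∀ i j, f (.inr i) ≠ .inr j := fun i j h => by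
    have := hf (.inr i); rw [h] at this; exact this
  have hLR : ∀ w j, f (.inl w) = .inr j → G.Adj w v := fun w j h => by
    have := hf (.inl w); rw [h] at this; exact this
  have hRL : ∀ i z, f (.inr i) = .inl z → G.Adj u z := fun i z h => by
    have := hf (.inr i); rw [h] at this; exact this
  have hLL : ∀ w z, f (.inl w) = .inl z →
      z = w ∨ (G.Adj w z ∧ w ≠ u ∧ w ≠ v ∧ z ≠ u ∧ z ≠ v ∧ ¬ G.Adj u z) := fun w z h => by
    have := hf (.inl w); rw [h] at this; exact this
  have hfu : f (.inl u) = .inl u := by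
    rcases h : f (.inl u) with z | j
    · rcases hLL _ _ h with rfl | h'
      · rfl
      · exact absurd rfl h'.2.1
    · exact absurd (hLR _ _ h) hadj
  have hfv : f (.inl v) = .inl v := by
    rcases h : f (.inl v) with z | j
    · rcases hLL _ _ h with rfl | h'
      · rfl
      · exact absurd rfl h'.2.2.1
    · exact absurd (hLR _ _ h) (G.irrefl)
  let l : V ⊕ Fin k → V := Sum.elim id fun _ => u
  let r : V ⊕ Fin k → V := Sum.elim id fun _ => v
  have htot : ∑ a, (x (l a) - x (r (f a))) = k * (x u - x v) := by
    rw [sum_sub_distrib, hbij.sum_comp (fun b => x (r b))]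
    simp only [Fintype.sum_sum_type, l, r, Sum.elim_inl, Sum.elim_inr, id, sum_const, card_univ,
      Fintype.card_fin, nsmul_eq_mul]
    ring
  -- Unused vertices and pairs of vertices traversed in both directions; their terms cancel.
  let C : Finset (V ⊕ Fin k) :=
    {a | ∃ w z, a = .inl w ∧ f a = .inl z ∧ f (.inl z) = .inl w}
  have memC : ∀ a, a ∈ C ↔ ∃ w z, a = .inl w ∧ f a = .inl z ∧ f (.inl z) = .inl w :=
    fun a => by simp [C]
  have hC : ∑ a ∈ C, (x (l a) - x (r (f a))) = 0 := by
    refine sum_involution (fun a _ => f a) ?_ ?_ ?_ ?_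
    · intro a ha
      obtain ⟨w, z, rfl, h1, h2⟩ := (memC a).1 ha
      simp [h1, h2, l, r]
    · intro a ha hne hfa
      obtain ⟨w, z, rfl, h1, h2⟩ := (memC a).1 ha
      apply hne
      simp [hfa, l, r]
    · intro a ha
      obtain ⟨w, z, rfl, h1, h2⟩ := (memC a).1 ha
      rw [h1, memC]
      exact ⟨z, w, rfl, h2, h1⟩
    · intro a ha
      obtain ⟨w, z, rfl, h1, h2⟩ := (memC a).1 ha
      simp [h1, h2]
  have loopC : ∀ w, f (.inl w) = .inl w → Sum.inl w ∈ C := fun w h => (memC _).2 ⟨w, w, rfl, h, h⟩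
  have hB : ∑ a ∈ Cᶜ, (x (l a) - x (r (f a))) = k * (x u - x v) := by
    rw [← htot, ← sum_add_sum_compl C, hC, zero_add]
  have hstep : ∀ a ∈ Cᶜ, G.Adj (l a) (r (f a)) := by
    intro a ha
    rw [mem_compl] at ha
    rcases a with w | i
    · rcases h : f (.inl w) with z | j
      · rcases hLL _ _ h with rfl | h'
        · exact absurd (loopC _ h) ha
        · exact h'.1
      · exact hLR _ _ h
    · rcases h : f (.inr i) with z | j
      · exact hRL _ _ h
      · exact absurd h (noRR _ _)
  have hinjB : Set.InjOn (fun a => (l a, r (f a))) (Cᶜ : Finset (V ⊕ Fin k)) := by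
    intro a ha b hb hab
    rw [mem_coe, mem_compl] at ha hb
    simp only [Prod.mk.injEq] at hab
    rcases a with w | i <;> rcases b with z | j
    · simpa [l] using hab.1
    · have : w = u := hab.1
      subst this
      exact absurd (loopC _ hfu) ha
    · have : u = z := hab.1
      subst this
      exact absurd (loopC _ hfu) hb
    · rcases h : f (.inr i) with w | i'
      · rcases h' : f (.inr j) with z | j'
        · rw [h, h'] at hab
          have : w = z := hab.2
          exact hinj (by rw [h, h', this])
        · exact absurd h' (noRR _ _)
      · exact absurd h (noRR _ _)
  have hen : ∑ a ∈ Cᶜ, (x (l a) - x (r (f a))) ^ 2 ≤ G.dirichletEnergy x := by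
    have := G.sum_sq_le_dirichletEnergy x (Cᶜ.image fun a => (l a, r (f a))) (by
        intro p hp
        obtain ⟨a, ha, rfl⟩ := mem_image.1 hp
        exact hstep a ha) (by
        intro p hp hp'
        obtain ⟨a, ha, rfl⟩ := mem_image.1 hp
        obtain ⟨b, hb, hab⟩ := mem_image.1 hp'
        have hsa := hstep a ha
        have hsb := hstep b hb
        rw [mem_compl] at ha hb
        simp only [Prod.swap_prod_mk, Prod.mk.injEq] at hab
        obtain ⟨h1, h2⟩ := hab
        rcases a with w | i
        · rcases hw : f (.inl w) with z | j
          · rw [hw] at h1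
            rcases b with z' | j'
            · have : z' = z := h1
              subst this
              rcases hz : f (.inl z') with w' | j''
              · rw [hz] at h2
                have : w' = w := h2
                subst this
                exact ha ((memC _).2 ⟨_, _, rfl, hw, hz⟩)
              · rw [hz] at h2
                have : v = w := h2
                subst this
                exact ha (loopC _ hfv)
            · have : u = z := h1
              subst this
              have : Sum.inl w = Sum.inl u := hinj (hw.trans hfu.symm)
              rw [this] at ha
              exact ha (loopC _ hfu)
          · rw [hw] at h1
            rcases b with z' | j'
            · have : z' = v := h1
              subst this
              exact hb (loopC _ hfv)
            · exact huv h1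
        · rcases hw : f (.inr i) with z | j
          · rw [hw] at h1 hsa
            rcases b with z' | j'
            · rcases hz : f (.inl z') with w' | j''
              · rw [hz] at h2
                have : w' = u := h2
                subst this
                have : Sum.inl z' = Sum.inl w' := hinj (hz.trans hfu.symm)
                rw [this] at hb
                exact hb (loopC _ hfu)
              · rw [hz] at h2
                exact huv h2.symm
            · have : u = z := h1
              subst this
              exact G.irrefl hsa
          · exact noRR _ _ hw)
    rwa [sum_image hinjB] at this
  have hcard : #Cᶜ + G.degree u + 2 ≤ Fintype.card V + 2 * k := by
    rw [← card_toLeft_add_card_toRight (u := Cᶜ)]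
    have hr : #(Cᶜ : Finset (V ⊕ Fin k)).toRight ≤ k := by
      simpa using card_le_univ (Cᶜ : Finset (V ⊕ Fin k)).toRight
    have hN1 : #{w ∈ G.neighborFinset u | ¬ f (.inl w) = .inl w} ≤ k := by
      have hsub : ({w ∈ G.neighborFinset u | ¬ f (.inl w) = .inl w}).map
          (⟨Sum.inl, Sum.inl_injective⟩ : V ↪ V ⊕ Fin k) ⊆ univ.image fun i : Fin k => f (.inr i) := by
        intro b hb
        obtain ⟨w, hw, rfl⟩ := mem_map.1 hb
        rw [mem_filter, mem_neighborFinset] at hw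
        obtain ⟨a, ha⟩ := hbij.2 (.inl w)
        rcases a with p | i
        · rcases hLL _ _ ha with rfl | h'
          · exact absurd ha hw.2
          · exact absurd hw.1 h'.2.2.2.2.2
        · exact mem_image.2 ⟨i, mem_univ _, ha⟩
      calc _ = _ := (card_map _).symm
        _ ≤ _ := card_le_card hsub
        _ ≤ #(univ : Finset (Fin k)) := card_image_le
        _ = k := by simp
    have hN := card_filter_add_card_filter_not (s := G.neighborFinset u)
      (fun w => f (.inl w) = .inl w)
    rw [card_neighborFinset_eq_degree] at hN
    have hd : Disjoint (Cᶜ : Finset (V ⊕ Fin k)).toLeft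
        (insert u (insert v {w ∈ G.neighborFinset u | f (.inl w) = .inl w})) := by
      rw [Finset.disjoint_left]
      intro w hw hw'
      rw [mem_toLeft, mem_compl] at hw
      simp only [mem_insert, mem_filter] at hw'
      rcases hw' with rfl | rfl | h
      · exact hw (loopC _ hfu)
      · exact hw (loopC _ hfv)
      · exact hw (loopC _ h.2)
    have hl := card_le_univ ((Cᶜ : Finset (V ⊕ Fin k)).toLeft ∪
        (insert u (insert v {w ∈ G.neighborFinset u | f (.inl w) = .inl w})))
    rw [card_union_of_disjoint hd, card_insert_of_notMem (by simp [huv]),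
      card_insert_of_notMem (by simp [hadj])] at hl
    omega
  have hcard' : (#Cᶜ : ℝ) ≤ (Fintype.card V : ℝ) - 2 + 2 * k - G.degree u := by
    have : (#Cᶜ : ℝ) + G.degree u + 2 ≤ Fintype.card V + 2 * k := by exact_mod_cast hcard
    linarith
  rw [← hB]
  refine sq_sum_le_card_mul_sum_sq.trans ?_
  exact mul_le_mul hcard' hen (sum_nonneg fun _ _ => sq_nonneg _) ((Nat.cast_nonneg _).trans hcard')

/-! ### Energy estimates in `k`-connected graphs -/

/-- A vertex set `S` whose neighbours outside `S` all lie in a set `R` of fewer than `k` vertices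
exhausts, together with `R`, the vertices of a `k`-connected graph. -/
theorem IsKConnected.mem_or_mem_of_closed {G : SimpleGraph V} {k : ℕ}
    (hG : G.IsKConnected k) {S R : Finset V} (hR : #R < k) {u : V} (huS : u ∈ S) (huR : u ∉ R)
    (hcl : ∀ a ∈ S, ∀ b, G.Adj a b → b ∈ S ∨ b ∈ R) (w : V) : w ∈ S ∨ w ∈ R := by
  by_contra! hw
  have hp := (hG.2 R hR).preconnected (⟨u, huR⟩ : {v : V | v ∉ R}) (⟨w, hw.2⟩ : {v : V | v ∉ R})
  obtain ⟨p⟩ := hp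
  obtain ⟨d, -, hd1, hd2⟩ := p.exists_boundary_dart {z | (z : V) ∈ S} huS hw.1
  rcases hcl _ hd1 _ d.adj with h | h
  · exact hd2 h
  · exact d.snd.2 h

theorem IsKConnected.le_degree [DecidableEq V] {G : SimpleGraph V} [DecidableRel G.Adj] {k : ℕ}
    (hG : G.IsKConnected k) (v : V) : k ≤ G.degree v := by
  by_contra! h
  have key := hG.mem_or_mem_of_closed (S := {v}) (R := G.neighborFinset v) (u := v)
    (by simpa using h) (by simp) (by simp) (by
      intro a ha b hab
      rw [mem_singleton] at ha
      subst ha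
      exact Or.inr (by simpa using hab))
  have : (univ : Finset V) ⊆ {v} ∪ G.neighborFinset v := fun w _ => by
    rw [mem_union]; exact key w
  have h1 := card_le_card this
  have h2 := card_union_le {v} (G.neighborFinset v)
  have h3 := hG.1
  rw [card_singleton, card_neighborFinset_eq_degree] at h2
  rw [card_univ] at h1
  omega

/-- In a `k`-connected graph, the energy of `x` bounds its variation between two vertices. The
factor is the total length of `k` disjoint paths in which only `k` neighbours of `u` occur. -/
theorem IsKConnected.sq_mul_sub_le_mul_dirichletEnergy [DecidableEq V] {G : SimpleGraph V}
    [DecidableRel G.Adj] {k : ℕ} (hk : 1 ≤ k) (hG : G.IsKConnected k) {u v : V} (huv : u ≠ v)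
    (x : V → ℝ) :
    ((k : ℝ) * (x u - x v)) ^ 2
      ≤ ((Fintype.card V : ℝ) - 2 + 2 * k - G.degree u) * G.dirichletEnergy x := by
  classical
  by_cases hadj : G.Adj u v
  · -- The edge `uv` is one of the paths; the other `k - 1` avoid it.
    obtain ⟨k, rfl⟩ : ∃ j, k = j + 1 := ⟨k - 1, by omega⟩
    set H := G.deleteEdges {s(u, v)} with hH
    have Hadj : ∀ a b, H.Adj a b ↔ G.Adj a b ∧ s(a, b) ≠ s(u, v) := fun a b => by
      simp [hH, deleteEdges_adj]
    have hHuv : ¬ H.Adj u v := by simp [Hadj]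
    have hnb : H.neighborFinset u = (G.neighborFinset u).erase v := by
      ext b
      rw [mem_neighborFinset, mem_erase, mem_neighborFinset, Hadj]
      have : s(u, b) ≠ s(u, v) ↔ b ≠ v := by
        rw [Ne, Sym2.congr_right]
      rw [this, and_comm]
    have hdeg : G.degree u = H.degree u + 1 := by
      rw [← card_neighborFinset_eq_degree, ← card_neighborFinset_eq_degree, hnb,
        card_erase_add_one (by simpa using hadj)]
    have hmain := H.sq_mul_sub_le_mul_dirichletEnergy_of_not_adj huv hHuv k (by
      intro S R huS hvS hvR hcl
      by_contra! hlt
      by_cases hS : ∃ w ∈ S, w ≠ u ∧ w ∉ R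
      · obtain ⟨w, hwS, hwu, hwR⟩ := hS
        have := hG.mem_or_mem_of_closed (S := S.erase u) (R := insert u R) (u := w)
          ((card_insert_le _ _).trans_lt (by omega)) (mem_erase.2 ⟨hwu, hwS⟩)
          (by simp [hwu, hwR]) (by
            intro a ha b hab
            rw [mem_erase] at ha
            by_cases hbu : b = u
            · exact Or.inr (by simp [hbu])
            have hne : s(a, b) ≠ s(u, v) := by
              rw [Ne, Sym2.eq_iff]
              rintro (⟨h, -⟩ | ⟨-, h⟩)
              · exact ha.1 h
              · exact hbu h
            rcases hcl a ha.2 b ((Hadj _ _).2 ⟨hab, hne⟩) with h | h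
            · exact Or.inl (mem_erase.2 ⟨hbu, h⟩)
            · exact Or.inr (mem_insert_of_mem h)) v
        simp [hvS, hvR, huv.symm] at this
      · push Not at hS
        have hsub : H.neighborFinset u ⊆ R := by
          intro b hb
          rw [mem_neighborFinset] at hb
          rcases hcl u huS b hb with h | h
          · exact hS b h hb.ne'
          · exact h
        have h1 := card_le_card hsub
        have h2 := hG.le_degree u
        rw [card_neighborFinset_eq_degree] at h1
        omega) x
    have hE : H.dirichletEnergy x + (x u - x v) ^ 2 ≤ G.dirichletEnergy x :=
      G.dirichletEnergy_deleteEdge_add_le x hadj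
    have hdn : (H.degree u : ℝ) + 2 ≤ Fintype.card V := by
      have := G.degree_lt_card_verts u
      exact_mod_cast (by omega : H.degree u + 2 ≤ Fintype.card V)
    have hEH := H.dirichletEnergy_nonneg x
    rw [hdeg]
    push_cast
    generalize H.dirichletEnergy x = e at *
    generalize G.dirichletEnergy x = e' at *
    generalize x u - x v = s at *
    set M := (Fintype.card V : ℝ) - 2 + 2 * k - H.degree u with hM
    have hM0 : 0 ≤ M := by
      have : (0 : ℝ) ≤ k := by positivity
      linarith
    have h1 : (Fintype.card V : ℝ) - 2 + 2 * (k + 1) - (H.degree u + 1) = M + 1 := by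
      rw [hM]; ring
    rw [h1]
    have h2 : (M + 1) * (e + s ^ 2) ≤ (M + 1) * e' := by gcongr
    refine le_trans ?_ h2
    -- This is `2 k s² ≤ M s² + e`, an instance of the inequality of arithmetic and geometric means.
    rcases hM0.eq_or_lt with h0 | h0
    · rw [← h0] at hmain ⊢
      have : (k : ℝ) * s = 0 := by nlinarith [sq_nonneg ((k : ℝ) * s)]
      nlinarith
    · have h3 : 0 ≤ M * (M * s ^ 2 + e - 2 * k * s ^ 2) := by
        nlinarith [sq_nonneg (M * s - k * s)]
      have h4 := nonneg_of_mul_nonneg_right h3 h0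
      nlinarith
  · refine G.sq_mul_sub_le_mul_dirichletEnergy_of_not_adj huv hadj k ?_ x
    intro S R huS hvS hvR hcl
    by_contra! hlt
    by_cases hS : ∃ w ∈ S, w ∉ R
    · obtain ⟨w, hwS, hwR⟩ := hS
      have := hG.mem_or_mem_of_closed hlt hwS hwR hcl v
      tauto
    · push Not at hS
      have hsub : G.neighborFinset u ⊆ R := by
        intro b hb
        rw [mem_neighborFinset] at hb
        rcases hcl u huS b hb with h | h
        · exact hS b h
        · exact h
      have h1 := card_le_card hsub
      have h2 := hG.le_degree u
      rw [card_neighborFinset_eq_degree] at h1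
      omega

/-- Total squared deviation from the minimum, bounded by the energy: `k` neighbours of the minimum
`v` contribute at most the energy itself, `v` contributes nothing, and every other vertex at most
`(y u - y v) ^ 2`. -/
theorem IsKConnected.sum_sq_sub_le [DecidableEq V] {G : SimpleGraph V} [DecidableRel G.Adj] {k : ℕ}
    (hk : 1 ≤ k) (hG : G.IsKConnected k) (y : V → ℝ) {u v : V} (hu : ∀ i, y i ≤ y u)
    (hv : ∀ i, y v ≤ y i) :
    (k : ℝ) ^ 2 * ∑ i, (y i - y v) ^ 2
      ≤ (((Fintype.card V : ℝ) - k - 1) * ((Fintype.card V : ℝ) - 2 + 2 * k - G.degree u) + k ^ 2)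
        * G.dirichletEnergy y := by
  have hE := G.dirichletEnergy_nonneg y
  have hs : ((k : ℝ) * (y u - y v)) ^ 2
      ≤ ((Fintype.card V : ℝ) - 2 + 2 * k - G.degree u) * G.dirichletEnergy y := by
    by_cases huv : u = v
    · subst huv
      have h1 : (G.degree u : ℝ) + 1 ≤ Fintype.card V := by
        exact_mod_cast Nat.succ_le_of_lt (G.degree_lt_card_verts u)
      have h2 : (1 : ℝ) ≤ k := by exact_mod_cast hk
      rw [sub_self, mul_zero, zero_pow two_ne_zero]
      exact mul_nonneg (by linarith) hE
    · exact hG.sq_mul_sub_le_mul_dirichletEnergy hk huv y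
  obtain ⟨N, hN, hNk⟩ := exists_subset_card_eq
    ((hG.le_degree v).trans_eq (G.card_neighborFinset_eq_degree v).symm)
  have hvN : v ∉ N := fun h => by simpa using hN h
  have h1 : ∑ i ∈ N, (y i - y v) ^ 2 ≤ G.dirichletEnergy y := by
    have := G.sum_sq_le_dirichletEnergy y (N.image fun w => (w, v)) (by
        intro p hp
        obtain ⟨w, hw, rfl⟩ := mem_image.1 hp
        exact ((G.mem_neighborFinset _ _).1 (hN hw)).symm) (by
        intro p hp hp'
        obtain ⟨w, hw, rfl⟩ := mem_image.1 hp
        obtain ⟨z, hz, h⟩ := mem_image.1 hp'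
        simp only [Prod.swap_prod_mk, Prod.mk.injEq] at h
        rw [h.1] at hz
        exact hvN hz)
    rwa [sum_image (fun a _ b _ h => by simpa using h)] at this
  have h2 : ∑ i ∈ (insert v N)ᶜ, (y i - y v) ^ 2
      ≤ ((Fintype.card V : ℝ) - k - 1) * (y u - y v) ^ 2 := by
    have hc : (#(insert v N)ᶜ : ℝ) = (Fintype.card V : ℝ) - k - 1 := by
      rw [card_compl, card_insert_of_notMem hvN, hNk, Nat.cast_sub (by have := hG.1; omega)]
      push_cast
      ring
    rw [← hc, ← nsmul_eq_mul]
    refine sum_le_card_nsmul _ _ _ fun i _ => ?_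
    have := hu i
    have := hv i
    gcongr
  rw [← sum_add_sum_compl (insert v N), sum_insert hvN, sub_self]
  have hc : (0 : ℝ) ≤ (Fintype.card V : ℝ) - k - 1 := by
    have : (k : ℝ) + 1 ≤ Fintype.card V := by exact_mod_cast hG.1
    linarith
  have h3 := mul_le_mul_of_nonneg_left hs hc
  have h4 := mul_le_mul_of_nonneg_left (add_le_add h1 h2) (sq_nonneg (k : ℝ))
  nlinarith

/-! ### The quadratic form of the matrix `A_α` -/

theorem alphaMatrix_mulVec_apply [DecidableEq V] (G : SimpleGraph V) [DecidableRel G.Adj]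
    (α : ℝ) (x : V → ℝ) (i : V) :
    (G.alphaMatrix α).mulVec x i
      = α * (G.degree i * x i) + (1 - α) * ∑ j ∈ G.neighborFinset i, x j := by
  simp [alphaMatrix, Matrix.add_mulVec, Matrix.smul_mulVec, Matrix.mulVec_diagonal,
    adjMatrix_mulVec_apply]

theorem sum_mul_sum_neighborFinset (G : SimpleGraph V) [DecidableRel G.Adj] (x : V → ℝ) :
    ∑ i, x i * ∑ j ∈ G.neighborFinset i, x j
      = ∑ i, G.degree i * x i ^ 2 - G.dirichletEnergy x := by
  have h1 : ∑ i, ∑ j, (if G.Adj i j then x i ^ 2 else 0) = ∑ i, (G.degree i : ℝ) * x i ^ 2 :=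
    sum_congr rfl fun i _ => by
      rw [← sum_filter, sum_const, nsmul_eq_mul, ← neighborFinset_eq_filter,
        card_neighborFinset_eq_degree]
  have h2 : ∑ i, ∑ j, (if G.Adj i j then x j ^ 2 else 0) = ∑ i, (G.degree i : ℝ) * x i ^ 2 := by
    rw [← h1, sum_comm]
    simp only [G.adj_comm]
  have h3 : ∑ i, x i * ∑ j ∈ G.neighborFinset i, x j
      = ∑ i, ∑ j, if G.Adj i j then x i * x j else 0 :=
    sum_congr rfl fun i _ => by
      rw [neighborFinset_eq_filter, mul_sum, sum_filter]
  have h4 : ∑ i, ∑ j, (if G.Adj i j then (x i - x j) ^ 2 else 0)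
      = ∑ i, ∑ j, (if G.Adj i j then x i ^ 2 else 0)
        + ∑ i, ∑ j, (if G.Adj i j then x j ^ 2 else 0)
        - 2 * ∑ i, ∑ j, if G.Adj i j then x i * x j else 0 := by
    simp only [mul_sum, ← sum_add_distrib, ← sum_sub_distrib]
    refine sum_congr rfl fun i _ => sum_congr rfl fun j _ => ?_
    split_ifs <;> ring
  rw [dirichletEnergy, h4, h3, h1, h2]
  ring

theorem dirichletEnergy_abs_le (G : SimpleGraph V) [DecidableRel G.Adj] (x : V → ℝ) :
    G.dirichletEnergy (fun i => |x i|) ≤ G.dirichletEnergy x := by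
  unfold dirichletEnergy
  gcongr with i _ j _
  split_ifs
  · exact sq_le_sq.2 (abs_abs_sub_abs_le _ _)
  · rfl

/-- An eigenvector for `ρ_α`, written out coordinatewise. -/
theorem exists_eigenvector_alphaSpectralRadius [DecidableEq V] [Nonempty V] (G : SimpleGraph V)
    [DecidableRel G.Adj] (α : ℝ) :
    ∃ x : V → ℝ, x ≠ 0 ∧ ∀ i, G.alphaSpectralRadius α * x i
      = α * (G.degree i * x i) + (1 - α) * ∑ j ∈ G.neighborFinset i, x j := by
  obtain ⟨x, hx⟩ :=
    Module.End.HasEigenvalue.exists_hasEigenvector (G.isGreatest_alphaSpectralRadius α).1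
  refine ⟨x, hx.2, fun i => ?_⟩
  rw [← alphaMatrix_mulVec_apply, ← Matrix.toLin'_apply, hx.apply_eq_smul]
  rfl

/-- Minimizing over `t`: `p t² + q (y - t)²` is at least `pq / (p + q) y²`. -/
theorem mul_mul_sq_le (p q t y : ℝ) :
    p * q * y ^ 2 ≤ (p + q) * (p * t ^ 2 + q * (y - t) ^ 2) := by
  nlinarith [sq_nonneg ((p + q) * t - q * y)]

end SimpleGraph

/-! ### The bound on the spectral radius -/

open Finset SimpleGraph in
theorem proposition3p2 {V : Type*} [Fintype V] [DecidableEq V] (G : SimpleGraph V)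
    [DecidableRel G.Adj] (n m Δ k : ℕ) (α : ℝ)
    (hn : Fintype.card V = n) (hm : G.edgeFinset.card = m) (hΔ : G.maxDegree = Δ)
    (hk : 1 ≤ k) (hconn : G.IsKConnected k) (hirr : G.IsIrregular)
    (hα₀ : 0 ≤ α) (hα₁ : α < 1) :
    G.alphaSpectralRadius α <
      (Δ : ℝ) - ((1 - α) * ((n : ℝ) * Δ - 2 * m) * (k : ℝ) ^ 2) /
        (((n : ℝ) * Δ - 2 * m) * ((n : ℝ) ^ 2 - ((Δ : ℝ) - k + 2) * ((n : ℝ) - k))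
          + (1 - α) * n * (k : ℝ) ^ 2) := by
  have hkn : k < n := hn ▸ hconn.1
  have : Nonempty V := Fintype.card_pos_iff.1 (by omega)
  have hle : ∀ i, (G.degree i : ℝ) ≤ Δ := fun i => by
    exact_mod_cast hΔ ▸ G.degree_le_maxDegree i
  -- The total degree deficiency `a = n Δ - 2 m`.
  obtain ⟨a, ha⟩ : ∃ a : ℝ, a = (n : ℝ) * Δ - 2 * m := ⟨_, rfl⟩
  have hsum : ∑ i, ((Δ : ℝ) - G.degree i) = a := by
    have h := G.sum_degrees_eq_twice_card_edges
    rw [hm] at h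
    have h' : ∑ i, (G.degree i : ℝ) = 2 * m := by exact_mod_cast h
    rw [sum_sub_distrib, h', sum_const, card_univ, hn, nsmul_eq_mul, ha]
  have ha0 : 0 < a := by
    rw [← hsum]
    refine sum_pos' (fun i _ => sub_nonneg.2 (hle i)) ?_
    by_contra! h
    refine hirr ⟨Δ, fun i => ?_⟩
    have h1 := h i (mem_univ _)
    exact_mod_cast le_antisymm (hle i) (by linarith)
  have hβ : 0 < 1 - α := by linarith
  obtain ⟨x, hx0, hx⟩ := G.exists_eigenvector_alphaSpectralRadius α
  generalize G.alphaSpectralRadius α = ρ at *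
  rw [← ha]
  obtain ⟨u, hu⟩ := Finite.exists_max fun i => |x i|
  obtain ⟨v, hv⟩ := Finite.exists_min fun i => |x i|
  have hxu : 0 < |x u| := by
    obtain ⟨i, hi⟩ := Function.ne_iff.1 hx0
    exact (abs_pos.2 hi).trans_le (hu i)
  have hρu : ρ ≤ G.degree u := by
    refine le_of_mul_le_mul_right ?_ hxu
    have h1 : |∑ j ∈ G.neighborFinset u, x j| ≤ G.degree u * |x u| := by
      refine (abs_sum_le_sum_abs _ _).trans ?_
      rw [← card_neighborFinset_eq_degree, ← nsmul_eq_mul]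
      exact sum_le_card_nsmul _ _ _ fun j _ => hu j
    calc ρ * |x u| ≤ |ρ * x u| := by rw [abs_mul]; gcongr; exact le_abs_self _
      _ ≤ |α * (G.degree u * x u)| + |(1 - α) * ∑ j ∈ G.neighborFinset u, x j| := by
        rw [hx u]; exact abs_add_le _ _
      _ = α * (G.degree u * |x u|) + (1 - α) * |∑ j ∈ G.neighborFinset u, x j| := by
        rw [abs_mul, abs_mul, abs_mul, abs_of_nonneg hα₀, abs_of_pos hβ, Nat.abs_cast]
      _ ≤ α * (G.degree u * |x u|) + (1 - α) * (G.degree u * |x u|) := by gcongr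
      _ = G.degree u * |x u| := by ring
  have hΔn : (Δ : ℝ) + 1 ≤ n := by
    obtain ⟨w, hw⟩ := G.exists_maximal_degree_vertex
    have h := G.degree_lt_card_verts w
    exact_mod_cast (by omega : Δ + 1 ≤ n)
  have hk1 : (1 : ℝ) ≤ k := by exact_mod_cast hk
  have hkn1 : (k : ℝ) + 1 ≤ n := by exact_mod_cast hkn
  -- The total length `L` of `k` short disjoint paths starting at a vertex of degree `Δ`.
  obtain ⟨L, hL⟩ : ∃ L : ℝ, L = (n : ℝ) - 2 + 2 * k - Δ := ⟨_, rfl⟩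
  have hL0 : 0 < L := by linarith
  have hC : (n : ℝ) ^ 2 - ((Δ : ℝ) - k + 2) * ((n : ℝ) - k) = (n - k - 1) * L + k ^ 2 + L := by
    rw [hL]; ring
  obtain ⟨C, hCdef⟩ : ∃ C : ℝ, C = ((n : ℝ) - k - 1) * L + k ^ 2 := ⟨_, rfl⟩
  have hCk : (k : ℝ) ^ 2 ≤ C := by
    have : 0 ≤ ((n : ℝ) - k - 1) * L := mul_nonneg (by linarith) hL0.le
    linarith
  rw [hC, ← hCdef]
  have hk2 : 0 < (k : ℝ) ^ 2 := by positivity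
  have hC0 : 0 < C := hk2.trans_le hCk
  have hn0 : 0 < (n : ℝ) := by linarith
  have hβnk : 0 < (1 - α) * n * (k : ℝ) ^ 2 := by positivity
  have hD0 : 0 < a * (C + L) + (1 - α) * n * (k : ℝ) ^ 2 := by positivity
  rw [lt_sub_comm, div_lt_iff₀ hD0]
  rcases (hle u).lt_or_eq with hdu | hdu
  · -- A maximal entry at a vertex of smaller degree forces `ρ ≤ Δ - 1`.
    have h1 : (G.degree u : ℝ) + 1 ≤ Δ := by exact_mod_cast hdu
    have h2 : 1 ≤ (Δ : ℝ) - ρ := by linarith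
    have h3 : (1 - α) * a * (k : ℝ) ^ 2 ≤ a * C :=
      calc (1 - α) * a * (k : ℝ) ^ 2 ≤ 1 * a * (k : ℝ) ^ 2 := by gcongr; linarith
        _ ≤ a * C := by rw [one_mul]; gcongr
    have h4 : 0 < a * L := by positivity
    nlinarith [mul_le_mul_of_nonneg_right h2 hD0.le]
  have hW := hconn.sum_sq_sub_le hk (fun i => |x i|) hu hv
  rw [hn, hdu, ← hL, ← hCdef] at hW
  have hE := G.dirichletEnergy_abs_le x
  set E := G.dirichletEnergy fun i => |x i|
  have hS0 : 0 < ∑ i, |x i| ^ 2 := sum_pos' (fun i _ => sq_nonneg _) ⟨u, mem_univ _, by positivity⟩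
  -- The Rayleigh quotient identity, with `|x|` in place of `x` at no loss.
  have hQ : a * |x v| ^ 2 + (1 - α) * E ≤ (Δ - ρ) * ∑ i, |x i| ^ 2 := by
    have h1 : ρ * ∑ i, |x i| ^ 2
        = ∑ i, (G.degree i : ℝ) * |x i| ^ 2 - (1 - α) * G.dirichletEnergy x := by
      have h2 := G.sum_mul_sum_neighborFinset x
      have h3 : ρ * ∑ i, |x i| ^ 2 = α * ∑ i, (G.degree i : ℝ) * x i ^ 2
          + (1 - α) * ∑ i, x i * ∑ j ∈ G.neighborFinset i, x j := by
        rw [mul_sum, mul_sum, mul_sum, ← sum_add_distrib]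
        refine sum_congr rfl fun i _ => ?_
        rw [sq_abs]
        linear_combination x i * hx i
      rw [h3, h2]
      simp only [sq_abs]
      ring
    have h2 : a * |x v| ^ 2 ≤ ∑ i, ((Δ : ℝ) - G.degree i) * |x i| ^ 2 := by
      rw [← hsum, sum_mul]
      refine sum_le_sum fun i _ => ?_
      have := sub_nonneg.2 (hle i)
      have := hv i
      gcongr
    simp only [sub_mul, sum_sub_distrib, ← mul_sum] at h2
    have h3 := mul_le_mul_of_nonneg_left hE hβ.le
    rw [sub_mul (Δ : ℝ), h1]
    linarith
  have hfin : (a * C) * (n * ((1 - α) * k ^ 2)) * ∑ i, |x i| ^ 2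
      ≤ (a * C + n * ((1 - α) * k ^ 2)) * (n * (C * ((Δ - ρ) * ∑ i, |x i| ^ 2))) := by
    calc _ = ∑ i, (a * C) * (n * ((1 - α) * k ^ 2)) * |x i| ^ 2 := by rw [mul_sum]
      _ ≤ ∑ i, (a * C + n * ((1 - α) * k ^ 2))
          * (a * C * |x v| ^ 2 + n * ((1 - α) * k ^ 2) * (|x i| - |x v|) ^ 2) :=
        sum_le_sum fun i _ => mul_mul_sq_le _ _ _ _
      _ = (a * C + n * ((1 - α) * k ^ 2)) * (n * (C * (a * |x v| ^ 2)
          + (1 - α) * (k ^ 2 * ∑ i, (|x i| - |x v|) ^ 2))) := by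
        rw [← mul_sum, sum_add_distrib, sum_const, ← mul_sum, card_univ, hn, nsmul_eq_mul]
        ring
      _ ≤ (a * C + n * ((1 - α) * k ^ 2)) * (n * (C * (a * |x v| ^ 2) + (1 - α) * (C * E))) := by
        gcongr
      _ = (a * C + n * ((1 - α) * k ^ 2)) * (n * (C * (a * |x v| ^ 2 + (1 - α) * E))) := by ring
      _ ≤ _ := by gcongr
  have hfin' : (1 - α) * a * (k : ℝ) ^ 2 ≤ (Δ - ρ) * (a * C + (1 - α) * n * k ^ 2) := by
    refine le_of_mul_le_mul_left ?_ (by positivity : 0 < n * C * ∑ i, |x i| ^ 2)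
    linarith
  have hpos : 0 < (Δ : ℝ) - ρ := by
    have h1 : 0 < (1 - α) * a * (k : ℝ) ^ 2 := by positivity
    exact pos_of_mul_pos_left (h1.trans_le hfin') (by positivity)
  have : 0 < (Δ - ρ) * (a * L) := by positivity
  linarith
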